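/- Let $d\ge 1$, let $\Omega\subseteq\mathbb R^d$ be open with finite volume, and let $W(u)=u^2+W_{conc}(u)$, where $W_{conc}:\mathbb R\to\mathbb R$ is concave and $C^1$, $W\ge 0$ and $W(1)=W(-1)=0$. Let $V$ be an open set with $C^2$ boundary such that $\overline V$ is compact and $\overline V\subset\Omega$, and set $u_0=\chi_V-\chi_{V^c}$. Let $\varepsilon,\tau>0$ and $$E_\varepsilon(u)=\int_\Omega \frac\varepsilon2\|\nabla u\|^2+\frac{W(u)}\varepsilon\,dx .$$ Then the first convex-concave splitting step (with homogeneous Neumann boundary conditions), i.e. the minimization problem $$u_1\in\operatorname*{argmin}_{u\in H^1(\Omega)}\ \frac1{2\tau}\|u-u_0\|_{L^2(\Omega)}^2+\int_\Omega\frac\varepsilon2\|\nabla u\|^2+\frac{u^2+W_{conc}'(u_0)\,u}{\varepsilon}\,dx ,$$ has a solution $u_1$, which is unique up to equality almost everywhere in $\Omega$, and $$E_\varepsilon(u_1)\le\left(\sqrt2+\frac\varepsilon\tau\right)\mathrm{Per}(V).$$ In particular, if $\tau\ge\varepsilon$, then $E_\varepsilon(u_1)\le(\sqrt2+1)\,\mathrm{Per}(V)$.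 Here $\mathrm{Per}(V)=\sup\{\int_V\operatorname{div}\varphi\,dx:\varphi\in C_c^1(\mathbb R^d;\mathbb R^d),\ \|\varphi\|\le1\}$ is the perimeter of $V$. -/

import Mathlib

open MeasureTheory Set
open scoped Topology ContDiff ENNReal

namespace SharpInterface

noncomputable section

/-- `g` is a weak gradient of `u` on the open set `Ω`: both are locally integrable on `Ω`, and
`∫_Ω u ∇ψ = - ∫_Ω ψ g` for every smooth `ψ` with compact support in `Ω`. -/
def HasWeakGradient {d : ℕ} (Ω : Set (EuclideanSpace ℝ (Fin d)))
    (u : EuclideanSpace ℝ (Fin d) → ℝ)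
    (g : EuclideanSpace ℝ (Fin d) → EuclideanSpace ℝ (Fin d)) : Prop :=
  LocallyIntegrableOn u Ω ∧ LocallyIntegrableOn g Ω ∧
    ∀ ψ : EuclideanSpace ℝ (Fin d) → ℝ,
      ContDiff ℝ ∞ ψ → HasCompactSupport ψ → tsupport ψ ⊆ Ω →
        ∫ x in Ω, u x • gradient ψ x = - ∫ x in Ω, ψ x • g x

open Classical in
/-- The weak gradient of `u` on `Ω`. It is unique up to a null set where it exists; the value is
`0` if there is none. -/
def weakGradient {d : ℕ} (Ω : Set (EuclideanSpace ℝ (Fin d)))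
    (u : EuclideanSpace ℝ (Fin d) → ℝ) :
    EuclideanSpace ℝ (Fin d) → EuclideanSpace ℝ (Fin d) :=
  if h : ∃ g, HasWeakGradient Ω u g then h.choose else 0

/-- Membership in the Sobolev space `H¹(Ω)`. -/
def MemH1 {d : ℕ} (Ω : Set (EuclideanSpace ℝ (Fin d)))
    (u : EuclideanSpace ℝ (Fin d) → ℝ) : Prop :=
  MemLp u 2 (volume.restrict Ω) ∧
    ∃ g, HasWeakGradient Ω u g ∧ MemLp g 2 (volume.restrict Ω)

/-- The divergence of a vector field on `ℝᵈ`. -/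
def divergence {d : ℕ} (φ : EuclideanSpace ℝ (Fin d) → EuclideanSpace ℝ (Fin d))
    (x : EuclideanSpace ℝ (Fin d)) : ℝ :=
  ∑ i : Fin d, fderiv ℝ φ x (EuclideanSpace.single i 1) i

/-- The (De Giorgi) perimeter of a set `V ⊆ ℝᵈ`: the supremum of `∫_V div φ` over all compactly
supported `C¹` vector fields `φ` with `‖φ‖ ≤ 1` everywhere. -/
def perimeter {d : ℕ} (V : Set (EuclideanSpace ℝ (Fin d))) : ℝ≥0∞ :=
  ⨆ (φ : EuclideanSpace ℝ (Fin d) → EuclideanSpace ℝ (Fin d)) (_ : ContDiff ℝ 1 φ)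
    (_ : HasCompactSupport φ) (_ : ∀ x, ‖φ x‖ ≤ 1),
    ENNReal.ofReal (∫ x in V, divergence φ x)

/-- The open set `V` has a `C²` boundary: near each of its boundary points, `V` is the sublevel
set `{f < 0}` of a `C²` function `f` with nonvanishing derivative at that point. -/
def HasC2Boundary {d : ℕ} (V : Set (EuclideanSpace ℝ (Fin d))) : Prop :=
  ∀ x ∈ frontier V, ∃ (U : Set (EuclideanSpace ℝ (Fin d)))
    (f : EuclideanSpace ℝ (Fin d) → ℝ),
    IsOpen U ∧ x ∈ U ∧ ContDiffOn ℝ 2 f U ∧ f x = 0 ∧ fderiv ℝ f x ≠ 0 ∧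
      V ∩ U = {y ∈ U | f y < 0}

/-- The sharp interface function `χ_V - χ_{Vᶜ}`. -/
def sharpInterface {d : ℕ} (V : Set (EuclideanSpace ℝ (Fin d)))
    (x : EuclideanSpace ℝ (Fin d)) : ℝ :=
  V.indicator 1 x - Vᶜ.indicator 1 x

/-- The Modica-Mortola energy `E_ε(u) = ∫_Ω ε/2 ‖∇u‖² + W(u)/ε`, in `[0,∞]`
(for a nonnegative potential `W`). -/
def energy {d : ℕ} (Ω : Set (EuclideanSpace ℝ (Fin d))) (W : ℝ → ℝ) (ε : ℝ)
    (u : EuclideanSpace ℝ (Fin d) → ℝ) : ℝ≥0∞ :=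
  ∫⁻ x in Ω, ENNReal.ofReal (ε / 2 * ‖weakGradient Ω u x‖ ^ 2 + W (u x) / ε)

/-- The objective of one convex-concave splitting step of size `τ` from `u₀`, for the potential
`u² + Wconc(u)`, where the concave part is linearised at `u₀`. -/
def stepFunctional {d : ℕ} (Ω : Set (EuclideanSpace ℝ (Fin d))) (Wconc : ℝ → ℝ) (ε τ : ℝ)
    (u₀ u : EuclideanSpace ℝ (Fin d) → ℝ) : ℝ :=
  1 / (2 * τ) * (∫ x in Ω, (u x - u₀ x) ^ 2)
    + ∫ x in Ω, (ε / 2 * ‖weakGradient Ω u x‖ ^ 2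
        + (u x ^ 2 + deriv Wconc (u₀ x) * u x) / ε)

/-- `u₁` is a result of the convex-concave splitting step: a minimizer over `H¹(Ω)` of the step
functional (natural, i.e. homogeneous Neumann, boundary conditions). -/
def IsSplittingStep {d : ℕ} (Ω : Set (EuclideanSpace ℝ (Fin d))) (Wconc : ℝ → ℝ) (ε τ : ℝ)
    (u₀ u₁ : EuclideanSpace ℝ (Fin d) → ℝ) : Prop :=
  MemH1 Ω u₁ ∧ ∀ u, MemH1 Ω u →
    stepFunctional Ω Wconc ε τ u₀ u₁ ≤ stepFunctional Ω Wconc ε τ u₀ u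

end

end SharpInterface

/-! At a zero s of W the nonnegative function W has a minimum, so W_conc'(s) = -2s. As u₀ only takes
the values ±1, completing the square turns the step functional into the quadratic energy Q(u) = ∫_Ω
a (u - u₀)² + b |∇u|² minus a constant, with a = 1/(2τ) + 1/ε and b = ε/2. Existence and uniqueness
are then projection onto a closed subspace of L² × L² and strict convexity. The tangent line of
W_conc at s gives W(t) ≤ (t - s)², so E_ε(u₁) ≤ Q(u₁) = min Q.

It remains to show min Q ≤ 2bk Per(V) with k² = a/b (`quadEnergy_le_perimeter`). Mollify χ_V to f,
solve Δv = k²(v - f) on the whole space, and use 2v - 1 as competitor. Integration by parts gives ∫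
k²(v - f)² + |∇v|² = -∫ f Δv, which is f tested against the divergence of -∇v. Mollification does
not increase total variation, so this is at most sup |∇v| · Per(V).

The core is the sharp bound |∇v| ≤ k/2 (`norm_gradient_le`): for 0 ≤ f ≤ 1, the difference of v and
its reflection in a hyperplane lies below the barrier 1 - exp(-kt), t being the distance to the
hyperplane, by the maximum principle. Differentiating at t = 0 gives 2 ∂_e v ≤ k. Finally 2bk = √(2
+ ε/τ) ≤ √2 + ε/τ. -/

namespace SharpInterface

open scoped SchwartzMap Laplacian LineDeriv RealInnerProductSpace

/-! ### The resolvent equation in Schwartz space -/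

section Resolvent

variable {E : Type*} [NormedAddCommGroup E] [InnerProductSpace ℝ E] [FiniteDimensional ℝ E]

theorem laplacian_postcompCLM {F G : Type*} [NormedAddCommGroup F] [NormedSpace ℝ F]
    [NormedAddCommGroup G] [NormedSpace ℝ G] (L : F →L[ℝ] G) (f : 𝓢(E, F)) :
    Δ (f.postcompCLM L) = (Δ f).postcompCLM L := by
  ext x
  rw [SchwartzMap.laplacian_apply, SchwartzMap.postcompCLM_apply, SchwartzMap.laplacian_apply]
  exact ((f.smooth 2).contDiffAt).laplacian_CLM_comp_left (l := L)

variable [MeasurableSpace E] [BorelSpace E]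

/-- The Laplacian has Fourier symbol -(2π)²|ξ|², so the solution operator is the multiplier 1/(1 +
|cξ|²) with c = 2π/k. Staying among Schwartz functions gives the decay needed for the maximum
principle and for every integration by parts. -/
theorem exists_complex_resolvent {k : ℝ} (hk : 0 < k) (f : 𝓢(E, ℂ)) :
    ∃ v : 𝓢(E, ℂ), Δ v = k ^ 2 • (v - f) := by
  set c : ℝ := 2 * Real.pi / k with hc
  set m : E → ℝ := fun ξ ↦ (1 + ‖c • ξ‖ ^ 2) ^ (-1 : ℝ) with hm
  have hmT : m.HasTemperateGrowth :=
    (Function.hasTemperateGrowth_one_add_norm_sq_rpow E (-1)).comp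
      (c • ContinuousLinearMap.id ℝ E).hasTemperateGrowth
  have hnT : (fun ξ : E ↦ ‖ξ‖ ^ 2).HasTemperateGrowth := by fun_prop
  refine ⟨SchwartzMap.fourierMultiplierCLM ℂ m f, ?_⟩
  have h1 : (fun ξ : E ↦ ‖ξ‖ ^ 2) * m = (c ^ 2)⁻¹ • ((fun _ ↦ (1 : ℝ)) - m) := by
    ext ξ
    have hc0 : c ≠ 0 := by positivity
    have : (1 + c ^ 2 * ‖ξ‖ ^ 2) ≠ 0 := by positivity
    simp only [hm, Pi.mul_apply, Pi.smul_apply, Pi.sub_apply, smul_eq_mul, Real.rpow_neg_one,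
      norm_smul, mul_pow, Real.norm_eq_abs, sq_abs]
    field_simp
    ring
  have h1T : (fun _ : E ↦ (1 : ℝ)).HasTemperateGrowth := by fun_prop
  have h2 : SchwartzMap.fourierMultiplierCLM ℂ ((fun _ ↦ (1 : ℝ)) - m) f
      = f - SchwartzMap.fourierMultiplierCLM ℂ m f := by
    rw [SchwartzMap.fourierMultiplierCLM_apply, SchwartzMap.smulLeftCLM_sub h1T hmT]
    simp [SchwartzMap.fourierMultiplierCLM_apply, sub_eq_add_neg, FourierTransform.fourierInv_add,
      FourierTransform.fourierInv_neg]
  rw [SchwartzMap.laplacian_eq_fourierMultiplierCLM]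
  have h3 : SchwartzMap.fourierMultiplierCLM ℂ (fun ξ : E ↦ ‖ξ‖ ^ 2)
      (SchwartzMap.fourierMultiplierCLM ℂ m f)
      = (c ^ 2)⁻¹ • (f - SchwartzMap.fourierMultiplierCLM ℂ m f) := by
    rw [SchwartzMap.fourierMultiplierCLM_fourierMultiplierCLM_apply hnT hmT, h1,
      SchwartzMap.fourierMultiplierCLM_smul (h1T.sub hmT), ← h2]
    rfl
  have h4 : -(2 * Real.pi) ^ 2 * (c ^ 2)⁻¹ = - k ^ 2 := by
    rw [hc]; field_simp
  change -(2 * Real.pi) ^ 2 • SchwartzMap.fourierMultiplierCLM ℂ (fun ξ : E ↦ ‖ξ‖ ^ 2)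
      (SchwartzMap.fourierMultiplierCLM ℂ m f) = _
  rw [h3, smul_smul, h4, neg_smul, ← smul_neg, neg_sub]

/-- The resolvent equation `Δ v = k² (v - f)` is solvable in the Schwartz space. -/
theorem exists_resolvent {k : ℝ} (hk : 0 < k) (f : 𝓢(E, ℝ)) :
    ∃ v : 𝓢(E, ℝ), ∀ x, (Δ v) x = k ^ 2 * (v x - f x) := by
  obtain ⟨v, hv⟩ := exists_complex_resolvent hk (f.postcompCLM Complex.ofRealCLM)
  -- The equation has real coefficients and real data, so the real part of a complex solution solves
  -- it.
  refine ⟨v.postcompCLM Complex.reCLM, fun x ↦ ?_⟩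
  rw [laplacian_postcompCLM, hv]
  simp

end Resolvent

/-! ### Maximum principle and the sharp gradient bound -/

section MaximumPrinciple

variable {E : Type*} [NormedAddCommGroup E] [InnerProductSpace ℝ E] [FiniteDimensional ℝ E]

/-- A positive second derivative would make t a local minimum as well, hence h locally constant with
vanishing second derivative. -/
theorem deriv_deriv_nonpos_of_isLocalMax {h : ℝ → ℝ} {t : ℝ} (hmax : IsLocalMax h t)
    (hc : ContinuousAt h t) : deriv (deriv h) t ≤ 0 := by
  by_contra! hpos
  have hmin := isLocalMin_of_deriv_deriv_pos hpos hmax.deriv_eq_zero hc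
  have : h =ᶠ[𝓝 t] fun _ ↦ h t := by
    filter_upwards [hmax, hmin] with s h1 h2 using le_antisymm h1 h2
  rw [this.deriv.deriv_eq] at hpos
  simp at hpos

theorem deriv_comp_line {E F : Type*} [NormedAddCommGroup E] [NormedSpace ℝ E]
    [NormedAddCommGroup F] [NormedSpace ℝ F] {g : E → F}
    (hg : Differentiable ℝ g) (y b : E) (t : ℝ) :
    HasDerivAt (fun t : ℝ ↦ g (y + t • b)) (fderiv ℝ g (y + t • b) b) t := by
  have hl : HasDerivAt (fun t : ℝ ↦ y + t • b) b t := by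
    simpa using ((hasDerivAt_id t).smul_const b).const_add y
  exact (hg (y + t • b)).hasFDerivAt.comp_hasDerivAt t hl

theorem iteratedFDeriv_two_diag {E : Type*} [NormedAddCommGroup E] [NormedSpace ℝ E]
    {p : E → ℝ} (hp : ContDiff ℝ 2 p) (y b : E) :
    iteratedFDeriv ℝ 2 p y ![b, b] = deriv (deriv fun t : ℝ ↦ p (y + t • b)) 0 := by
  have h1 : (deriv fun t : ℝ ↦ p (y + t • b)) = fun t ↦ fderiv ℝ p (y + t • b) b := by
    ext t
    exact (deriv_comp_line (hp.differentiable (by norm_num)) y b t).deriv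
  have h2 : Differentiable ℝ (fderiv ℝ p) :=
    (hp.fderiv_right (m := 1) (by norm_num)).differentiable (by norm_num)
  have h3 := ((ContinuousLinearMap.apply ℝ ℝ b).hasFDerivAt.comp_hasDerivAt 0
    (deriv_comp_line h2 y b 0)).deriv
  rw [h1, iteratedFDeriv_two_apply]
  refine Eq.trans ?_ h3.symm
  simp

theorem laplacian_nonpos_of_isLocalMax {p : E → ℝ} (hp : ContDiff ℝ 2 p) {y : E}
    (hmax : IsLocalMax p y) : (Δ p) y ≤ 0 := by
  rw [InnerProductSpace.laplacian_eq_iteratedFDeriv_orthonormalBasis p (stdOrthonormalBasis ℝ E)]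
  refine Finset.sum_nonpos fun i _ ↦ ?_
  rw [iteratedFDeriv_two_diag hp]
  set b := stdOrthonormalBasis ℝ E i
  have hc : Continuous fun t : ℝ ↦ y + t • b := by fun_prop
  refine deriv_deriv_nonpos_of_isLocalMax ?_ (hp.continuous.comp hc).continuousAt
  have : Filter.Tendsto (fun t : ℝ ↦ y + t • b) (𝓝 0) (𝓝 y) := by
    simpa using hc.tendsto 0
  simpa [IsLocalMax, IsMaxFilter] using this.eventually hmax

/-- The Laplacian may be computed in any orthonormal basis; the image under R of the standard one
makes both sides agree term by term. -/
theorem laplacian_comp_add_linearIsometryEquiv {p : E → ℝ} (hp : ContDiff ℝ 2 p) (R : E ≃ₗᵢ[ℝ] E) (x y : E) :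
    (Δ fun z ↦ p (x + R z)) y = (Δ p) (x + R y) := by
  have hb := InnerProductSpace.laplacian_eq_iteratedFDeriv_orthonormalBasis p
    ((stdOrthonormalBasis ℝ E).map R)
  rw [InnerProductSpace.laplacian_eq_iteratedFDeriv_orthonormalBasis _ (stdOrthonormalBasis ℝ E),
    hb]
  refine Finset.sum_congr rfl fun i _ ↦ ?_
  have h1 := (R.toContinuousLinearEquiv : E →L[ℝ] E).iteratedFDeriv_comp_right
    (f := fun z ↦ p (x + z)) (hp.comp (contDiff_const.add contDiff_id)) y (i := 2) le_rfl
  have h2 : (fun z ↦ p (x + R z)) = (fun z ↦ p (x + z)) ∘ (R.toContinuousLinearEquiv : E →L[ℝ] E) := rfl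
  rw [h2, h1, iteratedFDeriv_comp_add_left]
  simp only [ContinuousMultilinearMap.compContinuousLinearMap_apply, OrthonormalBasis.map_apply]
  congr 1
  ext j
  fin_cases j <;> rfl

theorem laplacian_exp_inner (k : ℝ) {e : E} (he : ‖e‖ = 1) (y : E) :
    (Δ fun z : E ↦ Real.exp (-k * ⟪e, z⟫)) y = k ^ 2 * Real.exp (-k * ⟪e, y⟫) := by
  have hs : ContDiff ℝ 2 fun z : E ↦ Real.exp (-k * ⟪e, z⟫) :=
    (contDiff_const.mul (contDiff_const.inner ℝ contDiff_id)).exp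
  rw [InnerProductSpace.laplacian_eq_iteratedFDeriv_orthonormalBasis _ (stdOrthonormalBasis ℝ E)]
  have h1 (b : E) : deriv (deriv fun t : ℝ ↦ Real.exp (-k * ⟪e, y + t • b⟫)) 0
      = k ^ 2 * Real.exp (-k * ⟪e, y⟫) * ⟪e, b⟫ ^ 2 := by
    have hl (t : ℝ) : HasDerivAt (fun t : ℝ ↦ -k * ⟪e, y + t • b⟫) (-k * ⟪e, b⟫) t := by
      simp only [inner_add_right, inner_smul_right]
      simpa using (((hasDerivAt_id t).mul_const ⟪e, b⟫).const_add ⟪e, y⟫).const_mul (-k)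
    have hd : (deriv fun t : ℝ ↦ Real.exp (-k * ⟪e, y + t • b⟫))
        = fun t ↦ Real.exp (-k * ⟪e, y + t • b⟫) * (-k * ⟪e, b⟫) := by
      ext t; exact (hl t).exp.deriv
    rw [hd, ((hl 0).exp.mul_const _).deriv]
    simp only [zero_smul, add_zero]
    ring
  simp_rw [iteratedFDeriv_two_diag hs, h1]
  rw [← Finset.mul_sum, (stdOrthonormalBasis ℝ E).sum_sq_inner_left, he]
  ring

/-- Comparison of an odd reflection difference of a solution with the one-dimensional barrier. -/
theorem reflection_difference_le {k : ℝ} (hk : 0 < k) {f v : 𝓢(E, ℝ)}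
    (hv : ∀ x, (Δ v) x = k ^ 2 * (v x - f x)) (hf0 : ∀ x, 0 ≤ f x) (hf1 : ∀ x, f x ≤ 1)
    {e : E} (he : ‖e‖ = 1) (x y : E) (hy : 0 ≤ ⟪e, y⟫) :
    v (x + y) - v (x + (ℝ ∙ e)ᗮ.reflection y) ≤ 1 - Real.exp (-k * ⟪e, y⟫) := by
  set R := (ℝ ∙ e)ᗮ.reflection with hR
  set I := LinearIsometryEquiv.refl ℝ E
  -- On the half-space ⟪e, z⟫ ≥ 0 the claim is m ≤ 1. Here m = 1 on the boundary, where R fixes z,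
  -- and the v-terms vanish at infinity, so a value above 1 forces an interior maximum. There Δm =
  -- k²(m - (f(x + z) - f(x + Rz))) > 0, because the difference of values of f is at most 1.
  set m : E → ℝ := fun z ↦ v (x + I z) - v (x + R z) + Real.exp (-k * ⟪e, z⟫) with hm
  have hv2 : ContDiff ℝ 2 v := v.smooth 2
  have hc1 (S : E ≃ₗᵢ[ℝ] E) : ContDiff ℝ 2 fun z ↦ v (x + S z) :=
    hv2.comp (contDiff_const.add S.toContinuousLinearEquiv.contDiff)
  have hc2 : ContDiff ℝ 2 fun z : E ↦ Real.exp (-k * ⟪e, z⟫) :=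
    (contDiff_const.mul (contDiff_const.inner ℝ contDiff_id)).exp
  have hmc : ContDiff ℝ 2 m := ((hc1 I).sub (hc1 R)).add hc2
  suffices m y ≤ 1 by simp only [hm, I, LinearIsometryEquiv.coe_refl, id] at this; linarith
  by_contra! hgt
  have hclosed : IsClosed {z : E | 0 ≤ ⟪e, z⟫} :=
    isClosed_le continuous_const (by fun_prop)
  have htend (S : E ≃ₗᵢ[ℝ] E) :
      Filter.Tendsto (fun z ↦ v (x + S z)) (Filter.cocompact E) (𝓝 0) := by
    have h1 : Filter.Tendsto v (Filter.cocompact E) (𝓝 0) := zero_at_infty v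
    exact h1.comp ((Homeomorph.addLeft x).isClosedEmbedding.tendsto_cocompact.comp
      S.toHomeomorph.isClosedEmbedding.tendsto_cocompact)
  have hsmall : ∀ᶠ z in Filter.cocompact E ⊓ Filter.principal {z : E | 0 ≤ ⟪e, z⟫}, m z ≤ m y := by
    have h0 : Filter.Tendsto (fun z ↦ v (x + I z) - v (x + R z)) (Filter.cocompact E) (𝓝 0) := by
      simpa using (htend I).sub (htend R)
    rw [Filter.eventually_inf_principal]
    filter_upwards [h0.eventually (gt_mem_nhds (sub_pos.2 hgt))] with z hz hz0
    have : Real.exp (-k * ⟪e, z⟫) ≤ 1 := by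
      rw [Real.exp_le_one_iff]
      have : 0 ≤ k * ⟪e, z⟫ := mul_nonneg hk.le hz0
      linarith
    simp only [hm] at hz ⊢
    linarith
  obtain ⟨z, hz0, hzmax⟩ := hmc.continuous.continuousOn.exists_isMaxOn' hclosed
    (x₀ := y) hy hsmall
  have hzgt : 1 < m z := hgt.trans_le (hzmax hy)
  have hzpos : 0 < ⟪e, z⟫ := by
    refine lt_of_le_of_ne hz0 fun h ↦ ?_
    have hmem : z ∈ (ℝ ∙ e)ᗮ := Submodule.mem_orthogonal_singleton_iff_inner_right.2 h.symm
    have hRz : R z = z := Submodule.reflection_mem_subspace_eq_self hmem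
    have hmz : m z = 1 := by simp [hm, hRz, ← h, I]
    linarith
  have hloc : IsLocalMax m z :=
    hzmax.isLocalMax (Filter.mem_of_superset
      ((isOpen_lt continuous_const (by fun_prop : Continuous fun z : E ↦ ⟪e, z⟫)).mem_nhds hzpos)
      fun w (hw : 0 < ⟪e, w⟫) ↦ hw.le)
  have hle := laplacian_nonpos_of_isLocalMax hmc hloc
  have hlap : (Δ m) z = k ^ 2 * (v (x + I z) - f (x + I z)) - k ^ 2 * (v (x + R z) - f (x + R z))
      + k ^ 2 * Real.exp (-k * ⟪e, z⟫) := by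
    have h1 : m = ((fun z ↦ v (x + I z)) - fun z ↦ v (x + R z))
      + fun z ↦ Real.exp (-k * ⟪e, z⟫) := rfl
    have h2 := ContDiffAt.laplacian_add (f₁ := (fun z ↦ v (x + I z)) - fun z ↦ v (x + R z))
      (x := z) ((hc1 I).sub (hc1 R)).contDiffAt hc2.contDiffAt
    rw [h1, h2, ContDiffAt.laplacian_sub (hc1 I).contDiffAt (hc1 R).contDiffAt,
      laplacian_comp_add_linearIsometryEquiv hv2, laplacian_comp_add_linearIsometryEquiv hv2,
      laplacian_exp_inner k he, ← SchwartzMap.laplacian_apply, ← SchwartzMap.laplacian_apply,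
      hv, hv]
  have h3 : (Δ m) z = k ^ 2 * (m z - (f (x + I z) - f (x + R z))) := by
    rw [hlap]; simp only [hm]; ring
  have h4 : 0 < k ^ 2 * (m z - (f (x + I z) - f (x + R z))) :=
    mul_pos (by positivity) (by linarith [hf0 (x + R z), hf1 (x + I z)])
  linarith

/-- With y = te, both sides of the reflection estimate vanish at t = 0, so their right derivatives
there compare: twice the directional derivative is at most k. -/
theorem fderiv_apply_le {k : ℝ} (hk : 0 < k) {f v : 𝓢(E, ℝ)}
    (hv : ∀ x, (Δ v) x = k ^ 2 * (v x - f x)) (hf0 : ∀ x, 0 ≤ f x) (hf1 : ∀ x, f x ≤ 1)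
    {e : E} (he : ‖e‖ = 1) (x : E) : fderiv ℝ v x e ≤ k / 2 := by
  have hle (t : ℝ) (ht : 0 ≤ t) : v (x + t • e) - v (x - t • e) ≤ 1 - Real.exp (-k * t) := by
    have hee : ⟪e, t • e⟫ = t := by simp [inner_smul_right, he]
    have h := reflection_difference_le hk hv hf0 hf1 he x (t • e) (by rw [hee]; exact ht)
    rw [hee, map_smul, Submodule.reflection_orthogonalComplement_singleton_eq_neg, smul_neg,
      ← sub_eq_add_neg] at h
    exact h
  have hd (s : ℝ) : HasDerivAt (fun t : ℝ ↦ v (x + t • (s • e))) (fderiv ℝ v x (s • e)) 0 := by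
    simpa using deriv_comp_line v.differentiable x (s • e) 0
  have hexp : HasDerivAt (fun t : ℝ ↦ 1 - Real.exp (-k * t)) k 0 := by
    have hl : HasDerivAt (fun t : ℝ ↦ -k * t) (-k) 0 := by
      simpa using (hasDerivAt_id (0 : ℝ)).const_mul (-k)
    simpa using hl.exp.const_sub 1
  have hder := (hexp.sub ((hd 1).sub (hd (-1))))
  have hlim := hder.tendsto_slope_zero_right
  have hnn : 0 ≤ k - (fderiv ℝ v x ((1 : ℝ) • e) - fderiv ℝ v x ((-1 : ℝ) • e)) := by
    refine ge_of_tendsto hlim ?_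
    filter_upwards [self_mem_nhdsWithin] with t ht
    have ht' : (0 : ℝ) < t := ht
    have := hle t ht'.le
    simp only [zero_add, Pi.sub_apply, one_smul, neg_smul, smul_neg, zero_smul, smul_eq_mul,
      mul_zero, Real.exp_zero, add_zero, neg_zero]
    refine mul_nonneg (by positivity) ?_
    rw [← sub_eq_add_neg x]
    linarith
  simp at hnn
  linarith

/-- The resolvent of a function with values in `[0, 1]` has gradient at most `k / 2`. -/
theorem norm_gradient_le {k : ℝ} (hk : 0 < k) {f v : 𝓢(E, ℝ)}
    (hv : ∀ x, (Δ v) x = k ^ 2 * (v x - f x)) (hf0 : ∀ x, 0 ≤ f x) (hf1 : ∀ x, f x ≤ 1)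
    (x : E) : ‖gradient v x‖ ≤ k / 2 := by
  rcases eq_or_ne (gradient v x) 0 with h0 | h0
  · rw [h0, norm_zero]; positivity
  · have h := fderiv_apply_le hk hv hf0 hf1 (norm_smul_inv_norm (𝕜 := ℝ) h0) x
    have h1 : fderiv ℝ v x (gradient v x) = ‖gradient v x‖ ^ 2 := by
      rw [← real_inner_self_eq_norm_sq, gradient, InnerProductSpace.toDual_symm_apply]
    have h2 : ‖gradient v x‖ ≠ 0 := norm_ne_zero_iff.2 h0
    rw [map_smul, h1, smul_eq_mul] at h
    simpa [pow_two, h2] using h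

end MaximumPrinciple

/-! ### Energy identity for the resolvent -/

section EnergyIdentity

variable {E : Type*} [NormedAddCommGroup E] [InnerProductSpace ℝ E] [FiniteDimensional ℝ E]

theorem fderiv_apply_eq_inner_gradient (v : E → ℝ) (x b : E) :
    fderiv ℝ v x b = ⟪gradient v x, b⟫ := by
  rw [gradient, InnerProductSpace.toDual_symm_apply]

theorem norm_gradient_sq_eq_sum (v : 𝓢(E, ℝ)) (x : E) :
    ‖gradient v x‖ ^ 2 = ∑ i, (∂_{stdOrthonormalBasis ℝ E i} v) x
      * (∂_{stdOrthonormalBasis ℝ E i} v) x := by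
  rw [← (stdOrthonormalBasis ℝ E).sum_sq_inner_left]
  refine Finset.sum_congr rfl fun i _ ↦ ?_
  rw [SchwartzMap.lineDerivOp_apply_eq_fderiv, fderiv_apply_eq_inner_gradient, pow_two]

variable [MeasurableSpace E] [BorelSpace E]

theorem integrable_schwartz_mul (f g : 𝓢(E, ℝ)) : Integrable fun x ↦ f x * g x :=
  (SchwartzMap.pairing (ContinuousLinearMap.mul ℝ ℝ) f g).integrable

theorem integrable_norm_gradient_sq (v : 𝓢(E, ℝ)) : Integrable fun x ↦ ‖gradient v x‖ ^ 2 := by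
  simp_rw [norm_gradient_sq_eq_sum]
  exact integrable_finsetSum _ fun i _ ↦ integrable_schwartz_mul _ _

theorem integral_norm_gradient_sq (v : 𝓢(E, ℝ)) :
    ∫ x, ‖gradient v x‖ ^ 2 = - ∫ x, v x * (Δ v) x := by
  simp_rw [norm_gradient_sq_eq_sum, SchwartzMap.laplacian_eq_sum (stdOrthonormalBasis ℝ E),
    sum_apply, Finset.mul_sum]
  rw [integral_finsetSum _ fun i _ ↦ integrable_schwartz_mul _ _,
    integral_finsetSum _ fun i _ ↦ integrable_schwartz_mul _ _, ← Finset.sum_neg_distrib]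
  refine Finset.sum_congr rfl fun i _ ↦ ?_
  rw [SchwartzMap.integral_mul_lineDerivOp_right_eq_neg_left]
  simp_rw [mul_comm]

/-- The energy of the solution of the resolvent equation. -/
theorem integral_resolvent_energy {k : ℝ} {f v : 𝓢(E, ℝ)}
    (hv : ∀ x, (Δ v) x = k ^ 2 * (v x - f x)) :
    ∫ x, (k ^ 2 * (v x - f x) ^ 2 + ‖gradient v x‖ ^ 2) = - ∫ x, f x * (Δ v) x := by
  -- By the equation this is (v - f) Δv; the part v Δv then cancels the Dirichlet integral.
  have h1 (x : E) : k ^ 2 * (v x - f x) ^ 2 = v x * (Δ v) x - f x * (Δ v) x := by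
    rw [hv]; ring
  simp_rw [h1]
  have hv1 := integrable_schwartz_mul v (Δ v)
  have hf1 := integrable_schwartz_mul f (Δ v)
  have hvf : Integrable fun x ↦ v x * (Δ v) x - f x * (Δ v) x := hv1.sub hf1
  rw [integral_add hvf (integrable_norm_gradient_sq v), integral_sub hv1 hf1,
    integral_norm_gradient_sq]
  ring

end EnergyIdentity

/-! ### Mollification and total variation -/

section Mollification

variable {d : ℕ}

local notation "𝔼" => EuclideanSpace ℝ (Fin d)

theorem divergence_comp_add_right (φ : 𝔼 → 𝔼) (t x : 𝔼) :
    divergence (fun y ↦ φ (y + t)) x = divergence φ (x + t) := by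
  simp [divergence, fderiv_comp_add_right]

theorem continuous_divergence {φ : 𝔼 → 𝔼} (hφ : ContDiff ℝ 1 φ) :
    Continuous (divergence φ) := by
  unfold divergence
  have := hφ.continuous_fderiv (by norm_num)
  fun_prop

theorem hasCompactSupport_divergence {φ : 𝔼 → 𝔼} (hφ : HasCompactSupport φ) :
    HasCompactSupport (divergence φ) := by
  refine (hφ.fderiv (𝕜 := ℝ)).mono fun x hx ↦ ?_
  contrapose! hx
  simp [divergence, Function.notMem_support.1 hx]

theorem setIntegral_divergence_le_perimeter {V : Set 𝔼} (hP : perimeter V ≠ ⊤) {φ : 𝔼 → 𝔼}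
    (hφ : ContDiff ℝ 1 φ) (hc : HasCompactSupport φ) (h1 : ∀ x, ‖φ x‖ ≤ 1) :
    ∫ x in V, divergence φ x ≤ (perimeter V).toReal := by
  refine (ENNReal.ofReal_le_iff_le_toReal hP).1 ?_
  unfold perimeter
  exact le_iSup_of_le φ (le_iSup_of_le hφ (le_iSup_of_le hc (le_iSup_of_le h1 le_rfl)))

/-- By Fubini the left side is the η-average over t of the integrals over V of the divergence of the
translates φ(· + t), each of which is admissible in the perimeter. -/
theorem integral_convolution_mul_divergence_le {V : Set 𝔼} (hVm : MeasurableSet V)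
    (hP : perimeter V ≠ ⊤) {η : 𝔼 → ℝ} (hη : Continuous η) (hηc : HasCompactSupport η)
    (hη0 : ∀ x, 0 ≤ η x) (hη1 : ∫ x, η x = 1) {φ : 𝔼 → 𝔼}
    (hφ : ContDiff ℝ 1 φ) (hc : HasCompactSupport φ) (h1 : ∀ x, ‖φ x‖ ≤ 1) :
    ∫ x, (∫ t, η t * V.indicator 1 (x - t)) * divergence φ x ≤ (perimeter V).toReal := by
  have hDc := continuous_divergence hφ
  have hDs := hasCompactSupport_divergence hc
  have hηi : Integrable η := hη.integrable_of_hasCompactSupport hηc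
  have hDi : Integrable (divergence φ) := hDc.integrable_of_hasCompactSupport hDs
  have hχ : Measurable (V.indicator (1 : 𝔼 → ℝ)) := measurable_one.indicator hVm
  have hint : Integrable (fun p : 𝔼 × 𝔼 ↦ η p.2 * V.indicator 1 (p.1 - p.2) * divergence φ p.1)
      (volume.prod volume) := by
    have h := (hDi.mul_prod hηi).bdd_mul (c := 1)
      (f := fun p : 𝔼 × 𝔼 ↦ V.indicator (1 : 𝔼 → ℝ) (p.1 - p.2))
      (hχ.comp (measurable_fst.sub measurable_snd)).aestronglyMeasurable
      (Filter.Eventually.of_forall fun p ↦ by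
        by_cases h : p.1 - p.2 ∈ V <;> simp [h])
    refine h.congr (Filter.Eventually.of_forall fun p ↦ ?_)
    ring
  have h2 : ∫ x, (∫ t, η t * V.indicator 1 (x - t)) * divergence φ x
      = ∫ t, η t * ∫ x in V, divergence (fun y ↦ φ (y + t)) x := by
    simp_rw [← integral_mul_const]
    rw [integral_integral_swap hint]
    refine integral_congr_ae (Filter.Eventually.of_forall fun t ↦ ?_)
    simp_rw [divergence_comp_add_right, mul_assoc]
    rw [integral_const_mul, ← integral_indicator hVm,
      ← integral_add_right_eq_self (fun x ↦ V.indicator 1 (x - t) * divergence φ x) t]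
    congr 2
    ext x
    by_cases hx : x ∈ V <;> simp [hx]
  have h3 (t : 𝔼) : ∫ x in V, divergence (fun y ↦ φ (y + t)) x ≤ (perimeter V).toReal :=
    setIntegral_divergence_le_perimeter hP (by fun_prop)
      (hc.comp_homeomorph (Homeomorph.addRight t)) fun x ↦ h1 _
  have h4 : Integrable fun t ↦ η t * ∫ x in V, divergence (fun y ↦ φ (y + t)) x := by
    have := hint.integral_prod_right
    refine this.congr (Filter.Eventually.of_forall fun t ↦ ?_)
    simp_rw [divergence_comp_add_right, mul_assoc]
    rw [integral_const_mul, ← integral_indicator hVm,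
      ← integral_add_right_eq_self (fun x ↦ V.indicator 1 (x - t) * divergence φ x) t]
    congr 2
    ext x
    by_cases hx : x ∈ V <;> simp [hx]
  rw [h2]
  calc ∫ t, η t * ∫ x in V, divergence (fun y ↦ φ (y + t)) x
      ≤ ∫ t, η t * (perimeter V).toReal :=
        integral_mono h4 (hηi.mul_const _) fun t ↦ mul_le_mul_of_nonneg_left (h3 t) (hη0 t)
    _ = (perimeter V).toReal := by rw [integral_mul_const, hη1, one_mul]

open scoped Convolution in
/-- Mollification of the characteristic function of a bounded set: it does not increase the
total variation and converges in `L²`. -/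
theorem exists_mollification {V : Set 𝔼} (hVm : MeasurableSet V) (hVb : Bornology.IsBounded V)
    {δ : ℝ} (hδ : 0 < δ) :
    ∃ f : 𝔼 → ℝ, ContDiff ℝ ∞ f ∧ HasCompactSupport f ∧ (∀ x, 0 ≤ f x) ∧ (∀ x, f x ≤ 1) ∧
      ∫ x, (f x - V.indicator 1 x) ^ 2 ≤ δ ∧
      (perimeter V ≠ ⊤ → ∀ φ : 𝔼 → 𝔼, ContDiff ℝ 1 φ → HasCompactSupport φ → (∀ x, ‖φ x‖ ≤ 1) →
        ∫ x, f x * divergence φ x ≤ (perimeter V).toReal) := by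
  set χ : 𝔼 → ℝ := V.indicator 1 with hχdef
  have hχm : Measurable χ := measurable_one.indicator hVm
  have hχ0 (x) : 0 ≤ χ x := indicator_nonneg (fun _ _ ↦ zero_le_one) x
  have hχ1 (x) : χ x ≤ 1 := indicator_le_self' (fun _ _ ↦ zero_le_one) x
  have hχi : Integrable χ := by
    rw [hχdef, integrable_indicator_iff hVm]
    exact integrableOn_const hVb.measure_lt_top.ne
  let r (n : ℕ) : ℝ := 1 / ((n : ℝ) + 1)
  have hr (n : ℕ) : 0 < r n := Nat.one_div_pos_of_nat
  have hr1 (n : ℕ) : r n ≤ 1 := by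
    rw [div_le_one (by positivity)]; simp
  let B (n : ℕ) : ContDiffBump (0 : 𝔼) := ⟨r n, 2 * r n, hr n, by linarith [hr n]⟩
  let η (n : ℕ) : 𝔼 → ℝ := (B n).normed volume
  let f (n : ℕ) : 𝔼 → ℝ := (η n) ⋆[ContinuousLinearMap.lsmul ℝ ℝ] χ
  have hfx (n x) : f n x = ∫ t, η n t * χ (x - t) := rfl
  have hηi (n) : Integrable (η n) := (B n).integrable_normed
  have hη0 (n t) : 0 ≤ η n t := (B n).nonneg_normed t
  have hη1 (n) : ∫ t, η n t = 1 := (B n).integral_normed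
  have hint (n x) : Integrable fun t ↦ η n t * χ (x - t) := by
    refine (hηi n).mul_bdd (c := 1)
      (hχm.comp (measurable_const.sub measurable_id)).aestronglyMeasurable
      (Filter.Eventually.of_forall fun t ↦ ?_)
    rw [Real.norm_of_nonneg (hχ0 _)]
    exact hχ1 _
  have hf0 (n x) : 0 ≤ f n x := integral_nonneg fun t ↦ mul_nonneg (hη0 n t) (hχ0 _)
  have hf1 (n x) : f n x ≤ 1 := by
    rw [hfx, ← hη1 n]
    exact integral_mono (hint n x) (hηi n) fun t ↦ mul_le_of_le_one_right (hη0 n t) (hχ1 _)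
  obtain ⟨R, hR⟩ := hVb.subset_closedBall 0
  have hsupp (n) (x) (hx : x ∉ Metric.closedBall (0 : 𝔼) (R + 2)) : f n x = 0 := by
    rw [hfx]
    refine integral_eq_zero_of_ae (Filter.Eventually.of_forall fun t ↦ ?_)
    by_cases ht : t ∈ Metric.ball (0 : 𝔼) (B n).rOut
    · have : x - t ∉ V := fun h ↦ hx <| by
        have h1 := hR h
        rw [mem_closedBall_zero_iff] at h1 ⊢
        rw [mem_ball_zero_iff] at ht
        have h2 : (B n).rOut = 2 * r n := rfl
        have h3 := norm_add_le (x - t) t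
        rw [sub_add_cancel] at h3
        linarith [hr1 n]
      simp [χ, this]
    · have : t ∉ Function.support (η n) := by rwa [(B n).support_normed_eq]
      simp [Function.notMem_support.1 this]
  have hχsupp (x) (hx : x ∉ Metric.closedBall (0 : 𝔼) (R + 2)) : χ x = 0 := by
    refine indicator_of_notMem (fun h ↦ hx ?_) _
    exact Metric.closedBall_subset_closedBall (by linarith) (hR h)
  have hsm (n) : ContDiff ℝ ∞ (f n) :=
    (B n).hasCompactSupport_normed.contDiff_convolution_left _ (B n).contDiff_normed
      hχi.locallyIntegrable
  have hcs (n) : HasCompactSupport (f n) :=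
    HasCompactSupport.intro (isCompact_closedBall 0 (R + 2)) (hsupp n)
  have hrt : Filter.Tendsto (fun n ↦ (B n).rOut) Filter.atTop (𝓝 0) := by
    have : Filter.Tendsto r Filter.atTop (𝓝 0) := tendsto_one_div_add_atTop_nhds_zero_nat
    simpa [B] using this.const_mul 2
  -- Lebesgue differentiation applies because the outer radius of each bump is twice its inner
  -- radius.
  have hae : ∀ᵐ x, Filter.Tendsto (fun n ↦ f n x) Filter.atTop (𝓝 (χ x)) :=
    ContDiffBump.ae_convolution_tendsto_right_of_locallyIntegrable (K := 2) hrt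
      (Filter.Eventually.of_forall fun n ↦ le_rfl) hχi.locallyIntegrable
  have hlim : Filter.Tendsto (fun n ↦ ∫ x, (f n x - χ x) ^ 2) Filter.atTop
      (𝓝 (∫ _ : 𝔼, (0 : ℝ))) := by
    refine tendsto_integral_of_dominated_convergence
      ((Metric.closedBall (0 : 𝔼) (R + 2)).indicator 1) (fun n ↦ ?_) ?_ (fun n ↦ ?_) ?_
    · exact (((hsm n).continuous.measurable.sub hχm).pow_const 2).aestronglyMeasurable
    · rw [integrable_indicator_iff measurableSet_closedBall]
      exact integrableOn_const measure_closedBall_lt_top.ne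
    · refine Filter.Eventually.of_forall fun x ↦ ?_
      by_cases hx : x ∈ Metric.closedBall (0 : 𝔼) (R + 2)
      · rw [indicator_of_mem hx, Pi.one_apply, Real.norm_of_nonneg (sq_nonneg _)]
        exact (sq_le_one_iff_abs_le_one _).2
          (abs_le.2 ⟨by linarith [hf0 n x, hχ1 x], by linarith [hf1 n x, hχ0 x]⟩)
      · rw [hsupp n x hx, hχsupp x hx, indicator_of_notMem hx]; simp
    · filter_upwards [hae] with x hx
      simpa using (hx.sub_const (χ x)).pow 2
  rw [integral_zero] at hlim
  obtain ⟨n, hn⟩ := (hlim.eventually (gt_mem_nhds hδ)).exists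
  refine ⟨f n, hsm n, hcs n, hf0 n, hf1 n, hn.le, fun hP φ hφ hc h1 ↦ ?_⟩
  exact integral_convolution_mul_divergence_le hVm hP (B n).continuous_normed
    (B n).hasCompactSupport_normed (hη0 n) (hη1 n) hφ hc h1

theorem exists_clm_gradient_eq :
    ∃ T : (𝔼 →L[ℝ] ℝ) →L[ℝ] 𝔼, (∀ l x, ⟪T l, x⟫ = l x) ∧
      ∀ v : 𝔼 → ℝ, gradient v = fun x ↦ T (fderiv ℝ v x) := by
  let T : (𝔼 →L[ℝ] ℝ) →ₗ[ℝ] 𝔼 :=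
    { toFun := (InnerProductSpace.toDual ℝ 𝔼).symm
      map_add' := map_add _
      map_smul' := by simp }
  exact ⟨LinearMap.toContinuousLinearMap T, fun l x ↦ InnerProductSpace.toDual_symm_apply,
    fun v ↦ rfl⟩

theorem divergence_gradient {v : 𝔼 → ℝ} (hv : ContDiff ℝ 2 v) (x : 𝔼) :
    divergence (gradient v) x = (Δ v) x := by
  rw [InnerProductSpace.laplacian_eq_iteratedFDeriv_orthonormalBasis v
    (EuclideanSpace.basisFun (Fin d) ℝ)]
  refine Finset.sum_congr rfl fun i _ ↦ ?_
  have h2 : DifferentiableAt ℝ (fderiv ℝ v) x :=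
    (hv.fderiv_right (m := 1) (by norm_num)).differentiable (by norm_num) x
  obtain ⟨T, hT, hgrad⟩ := exists_clm_gradient_eq (d := d)
  have h3 : HasFDerivAt (gradient v) (T.comp (fderiv ℝ (fderiv ℝ v) x)) x := by
    rw [hgrad]
    exact T.hasFDerivAt.comp x h2.hasFDerivAt
  rw [h3.fderiv, iteratedFDeriv_two_apply]
  simp only [EuclideanSpace.basisFun_apply, Matrix.cons_val_zero, Matrix.cons_val_one]
  have h4 (w : 𝔼) : w i = ⟪w, EuclideanSpace.single i (1 : ℝ)⟫ := by
    simp [EuclideanSpace.inner_single_right]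
  rw [h4]
  exact hT _ _

theorem contDiff_gradient {v : 𝔼 → ℝ} (hv : ContDiff ℝ 2 v) : ContDiff ℝ 1 (gradient v) := by
  obtain ⟨T, -, hgrad⟩ := exists_clm_gradient_eq (d := d)
  rw [hgrad]
  exact T.contDiff.comp (hv.fderiv_right (m := 1) (by norm_num))

/-- Testing a total variation bound with the gradient of a function. -/
theorem neg_integral_mul_laplacian_le {f : 𝔼 → ℝ} (hfc : HasCompactSupport f) {P : ℝ}
    (hf : ∀ φ : 𝔼 → 𝔼, ContDiff ℝ 1 φ → HasCompactSupport φ → (∀ x, ‖φ x‖ ≤ 1) →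
      ∫ x, f x * divergence φ x ≤ P)
    {v : 𝔼 → ℝ} (hv : ContDiff ℝ 2 v) {M : ℝ} (hM : 0 < M) (hvM : ∀ x, ‖gradient v x‖ ≤ M) :
    - ∫ x, f x * (Δ v) x ≤ M * P := by
  obtain ⟨R, hR⟩ := hfc.isCompact.isBounded.subset_ball 0
  let ζ : ContDiffBump (0 : 𝔼) := ⟨max R 1, max R 1 + 1, by positivity, by linarith⟩
  -- The cutoff supplies compact support; it equals 1 near the support of f, so it does not change
  -- the integral.
  let φ : 𝔼 → 𝔼 := fun x ↦ ζ x • ((-M⁻¹) • gradient v x)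
  have hφ : ContDiff ℝ 1 φ :=
    ContDiff.smul (ζ.contDiff (n := 1))
      ((contDiff_gradient hv).const_smul (-M⁻¹))
  have hφc : HasCompactSupport φ := ζ.hasCompactSupport.smul_right
  have hφ1 (x) : ‖φ x‖ ≤ 1 := by
    rw [norm_smul, norm_smul, Real.norm_of_nonneg ζ.nonneg, norm_neg, norm_inv,
      Real.norm_of_nonneg hM.le]
    refine mul_le_one₀ ζ.le_one (by positivity) ?_
    rw [inv_mul_le_one₀ hM]
    exact hvM x
  have h := hf φ hφ hφc hφ1
  have hdiv (x) (hx : x ∈ tsupport f) : divergence φ x = -M⁻¹ * (Δ v) x := by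
    have hxb : x ∈ Metric.ball (0 : 𝔼) ζ.rIn :=
      Metric.ball_subset_ball (le_max_left R 1) (hR hx)
    have he : φ =ᶠ[𝓝 x] (-M⁻¹) • gradient v := by
      filter_upwards [ζ.eventuallyEq_one_of_mem_ball hxb] with y hy
      simp [φ, hy]
    have hd : DifferentiableAt ℝ (gradient v) x :=
      (contDiff_gradient hv).differentiable (by norm_num) x
    rw [← divergence_gradient hv, divergence, divergence, he.fderiv_eq, fderiv_const_smul hd,
      Finset.mul_sum]
    rfl
  have h2 : ∫ x, f x * divergence φ x = -M⁻¹ * ∫ x, f x * (Δ v) x := by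
    rw [← integral_const_mul]
    refine integral_congr_ae (Filter.Eventually.of_forall fun x ↦ ?_)
    by_cases hx : x ∈ tsupport f
    · simp only [hdiv x hx]; ring
    · simp [image_eq_zero_of_notMem_tsupport hx]
  rw [h2] at h
  have h3 := mul_le_mul_of_nonneg_left h hM.le
  have h4 : M * (-M⁻¹ * ∫ x, f x * (Δ v) x) = - ∫ x, f x * (Δ v) x := by
    field_simp
  linarith

end Mollification

/-! ### Weak gradients and strict convexity -/

section SobolevPairs

variable {d : ℕ}

local notation "𝔼" => EuclideanSpace ℝ (Fin d)

/-- `u` is an `H¹(Ω)` function with weak gradient `g`. -/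
def IsH1Pair (Ω : Set 𝔼) (u : 𝔼 → ℝ) (g : 𝔼 → 𝔼) : Prop :=
  MemLp u 2 (volume.restrict Ω) ∧ HasWeakGradient Ω u g ∧ MemLp g 2 (volume.restrict Ω)

/-- The quadratic energy `∫_Ω a (u - u₀)² + b ‖g‖²`. -/
noncomputable def quadEnergy (Ω : Set 𝔼) (a b : ℝ) (u₀ u : 𝔼 → ℝ) (g : 𝔼 → 𝔼) : ℝ :=
  ∫ x in Ω, (a * (u x - u₀ x) ^ 2 + b * ‖g x‖ ^ 2)

theorem hasCompactSupport_gradient {ψ : 𝔼 → ℝ} (hc : HasCompactSupport ψ) :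
    HasCompactSupport (gradient ψ) := by
  obtain ⟨T, -, hgrad⟩ := exists_clm_gradient_eq (d := d)
  rw [hgrad]
  exact (hc.fderiv (𝕜 := ℝ)).comp_left (map_zero T)

theorem continuous_gradient {ψ : 𝔼 → ℝ} (hψ : ContDiff ℝ 1 ψ) : Continuous (gradient ψ) := by
  obtain ⟨T, -, hgrad⟩ := exists_clm_gradient_eq (d := d)
  rw [hgrad]
  exact T.continuous.comp (hψ.continuous_fderiv (by norm_num))

theorem ae_eq_of_hasWeakGradient {Ω : Set 𝔼} (hΩ : IsOpen Ω) {u : 𝔼 → ℝ} {g g' : 𝔼 → 𝔼}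
    (h : HasWeakGradient Ω u g) (h' : HasWeakGradient Ω u g') :
    g =ᵐ[volume.restrict Ω] g' := by
  have hloc : LocallyIntegrableOn (g - g') Ω := h.2.1.sub h'.2.1
  have hint {k : 𝔼 → 𝔼} (hk : LocallyIntegrableOn k Ω) {ψ : 𝔼 → ℝ} (hψ : ContDiff ℝ ∞ ψ)
      (hc : HasCompactSupport ψ) (hs : tsupport ψ ⊆ Ω) : Integrable fun x ↦ ψ x • k x := by
    have h1 : IntegrableOn k (tsupport ψ) := hk.integrableOn_compact_subset hs hc.isCompact
    obtain ⟨C, hC⟩ := hc.exists_bound_of_continuous hψ.continuous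
    refine (integrableOn_iff_integrable_of_support_subset ?_).1
      (h1.bdd_smul C hψ.continuous.aestronglyMeasurable (Filter.Eventually.of_forall hC))
    exact (Function.support_smul_subset_left _ _).trans (subset_tsupport ψ)
  have hz := hΩ.ae_eq_zero_of_integral_contDiff_smul_eq_zero hloc fun ψ hψ hc hs ↦ by
    have e1 := h.2.2 ψ hψ hc hs
    rw [h'.2.2 ψ hψ hc hs, neg_inj] at e1
    have hset (k : 𝔼 → 𝔼) : ∫ x in Ω, ψ x • k x = ∫ x, ψ x • k x :=
      setIntegral_eq_integral_of_forall_compl_eq_zero fun x hx ↦ by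
        rw [image_eq_zero_of_notMem_tsupport fun hx' ↦ hx (hs hx'), zero_smul]
    rw [hset, hset] at e1
    simp_rw [Pi.sub_apply, smul_sub]
    rw [integral_sub (hint h.2.1 hψ hc hs) (hint h'.2.1 hψ hc hs), e1, sub_self]
  rw [Filter.EventuallyEq, ae_restrict_iff' hΩ.measurableSet]
  filter_upwards [hz] with x hx hxΩ using sub_eq_zero.1 (hx hxΩ)

/-- Removes the arbitrary choice in `weakGradient`: under integrals any weak gradient may replace
it, so later arguments work with explicit pairs (u, g). -/
theorem weakGradient_ae_eq {Ω : Set 𝔼} (hΩ : IsOpen Ω) {u : 𝔼 → ℝ} {g : 𝔼 → 𝔼}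
    (h : HasWeakGradient Ω u g) : weakGradient Ω u =ᵐ[volume.restrict Ω] g := by
  have hex : ∃ g, HasWeakGradient Ω u g := ⟨g, h⟩
  rw [weakGradient, dif_pos hex]
  exact ae_eq_of_hasWeakGradient hΩ hex.choose_spec h

theorem locallyIntegrableOn_of_memLp {F : Type*} [NormedAddCommGroup F] {Ω : Set 𝔼}
    (hΩvol : volume Ω < ⊤) {k : 𝔼 → F} (hk : MemLp k 2 (volume.restrict Ω)) :
    LocallyIntegrableOn k Ω := by
  have : IsFiniteMeasure (volume.restrict Ω) := ⟨by simpa using hΩvol⟩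
  have h : IntegrableOn k Ω := hk.integrable one_le_two
  exact h.locallyIntegrableOn

theorem integrable_smul_of_memLp {F : Type*} [NormedAddCommGroup F] [NormedSpace ℝ F]
    {Ω : Set 𝔼} {k : 𝔼 → ℝ} {l : 𝔼 → F} (hk : MemLp k 2 (volume.restrict Ω))
    (hl : MemLp l 2 (volume.restrict Ω)) : Integrable (fun x ↦ k x • l x) (volume.restrict Ω) :=
  memLp_one_iff_integrable.1 (hl.smul hk)

theorem IsH1Pair.midpoint {Ω : Set 𝔼} (hΩvol : volume Ω < ⊤) {u u' : 𝔼 → ℝ} {g g' : 𝔼 → 𝔼}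
    (h : IsH1Pair Ω u g) (h' : IsH1Pair Ω u' g') :
    IsH1Pair Ω (fun x ↦ (1 / 2 : ℝ) • u x + (1 / 2 : ℝ) • u' x)
      (fun x ↦ (1 / 2 : ℝ) • g x + (1 / 2 : ℝ) • g' x) := by
  have hu : MemLp (fun x ↦ (1 / 2 : ℝ) • u x + (1 / 2 : ℝ) • u' x) 2 (volume.restrict Ω) :=
    (h.1.const_smul (1 / 2 : ℝ)).add (h'.1.const_smul (1 / 2 : ℝ))
  have hg : MemLp (fun x ↦ (1 / 2 : ℝ) • g x + (1 / 2 : ℝ) • g' x) 2 (volume.restrict Ω) :=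
    (h.2.2.const_smul (1 / 2 : ℝ)).add (h'.2.2.const_smul (1 / 2 : ℝ))
  refine ⟨hu, ⟨locallyIntegrableOn_of_memLp hΩvol hu, locallyIntegrableOn_of_memLp hΩvol hg,
    fun ψ hψ hc hs ↦ ?_⟩, hg⟩
  have hψ2 : MemLp ψ 2 (volume.restrict Ω) := hψ.continuous.memLp_of_hasCompactSupport hc
  have hψ'2 : MemLp (gradient ψ) 2 (volume.restrict Ω) :=
    (continuous_gradient (hψ.of_le (by norm_cast))).memLp_of_hasCompactSupport
      (hasCompactSupport_gradient hc)
  simp_rw [add_smul, smul_add, smul_assoc, smul_comm (ψ _) (1 / 2 : ℝ)]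
  rw [integral_add ((integrable_smul_of_memLp h.1 hψ'2).fun_smul (1 / 2 : ℝ))
      ((integrable_smul_of_memLp h'.1 hψ'2).fun_smul (1 / 2 : ℝ)),
    integral_add ((integrable_smul_of_memLp hψ2 h.2.2).fun_smul (1 / 2 : ℝ))
      ((integrable_smul_of_memLp hψ2 h'.2.2).fun_smul (1 / 2 : ℝ)),
    integral_smul, integral_smul, integral_smul, integral_smul,
    h.2.1.2.2 ψ hψ hc hs, h'.2.1.2.2 ψ hψ hc hs]
  simp only [smul_neg, neg_add]

theorem integrable_quadEnergy {Ω : Set 𝔼} {u₀ u : 𝔼 → ℝ} {g : 𝔼 → 𝔼} (a b : ℝ)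
    (hu₀ : MemLp u₀ 2 (volume.restrict Ω)) (hu : MemLp u 2 (volume.restrict Ω))
    (hg : MemLp g 2 (volume.restrict Ω)) :
    Integrable (fun x ↦ a * (u x - u₀ x) ^ 2 + b * ‖g x‖ ^ 2) (volume.restrict Ω) :=
  ((hu.sub hu₀).integrable_sq.const_mul a).add
    (((memLp_two_iff_integrable_sq_norm hg.1).1 hg).const_mul b)

/-- Strict convexity of the quadratic energy. -/
theorem ae_eq_of_quadEnergy_le_midpoint {Ω : Set 𝔼} {a b : ℝ} (ha : 0 < a) (hb : 0 ≤ b)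
    {u₀ u u' : 𝔼 → ℝ} {g g' : 𝔼 → 𝔼} (hΩvol : volume Ω < ⊤)
    (hu₀ : MemLp u₀ 2 (volume.restrict Ω)) (h : IsH1Pair Ω u g) (h' : IsH1Pair Ω u' g')
    (hmin : ∀ w k, IsH1Pair Ω w k → quadEnergy Ω a b u₀ u g ≤ quadEnergy Ω a b u₀ w k)
    (hmin' : ∀ w k, IsH1Pair Ω w k → quadEnergy Ω a b u₀ u' g' ≤ quadEnergy Ω a b u₀ w k) :
    u =ᵐ[volume.restrict Ω] u' := by
  have hm := h.midpoint hΩvol h'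
  have h1 := hmin _ _ hm
  have h2 := hmin' _ _ hm
  have i1 := integrable_quadEnergy a b hu₀ h.1 h.2.2
  have i2 := integrable_quadEnergy a b hu₀ h'.1 h'.2.2
  have i3 := integrable_quadEnergy a b hu₀ hm.1 hm.2.2
  have i4 : Integrable (fun x ↦ (u x - u' x) ^ 2) (volume.restrict Ω) :=
    (h.1.sub h'.1).integrable_sq
  -- Parallelogram law, discarding the gradient difference. By minimality of both pairs against the
  -- midpoint, the right side is at most 0.
  have hle : ∫ x in Ω, a / 2 * (u x - u' x) ^ 2 ≤ ∫ x in Ω,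
      ((a * (u x - u₀ x) ^ 2 + b * ‖g x‖ ^ 2) + (a * (u' x - u₀ x) ^ 2 + b * ‖g' x‖ ^ 2)
        - 2 * (a * (((1 / 2 : ℝ) • u x + (1 / 2 : ℝ) • u' x) - u₀ x) ^ 2
          + b * ‖(1 / 2 : ℝ) • g x + (1 / 2 : ℝ) • g' x‖ ^ 2)) := by
    refine integral_mono (i4.const_mul _) ((i1.add i2).sub (i3.const_mul 2)) fun x ↦ ?_
    have hn : ‖(1 / 2 : ℝ) • g x + (1 / 2 : ℝ) • g' x‖ ^ 2 ≤ (‖g x‖ ^ 2 + ‖g' x‖ ^ 2) / 2 := by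
      rw [← smul_add, norm_smul, mul_pow, Real.norm_of_nonneg (by norm_num)]
      have := parallelogram_law_with_norm ℝ (g x) (g' x)
      nlinarith [sq_nonneg ‖g x - g' x‖]
    have hb' := mul_le_mul_of_nonneg_left hn hb
    simp only [smul_eq_mul]
    nlinarith
  rw [integral_sub (i1.fun_add i2) (i3.const_mul 2), integral_add i1 i2, integral_const_mul,
    integral_const_mul] at hle
  unfold quadEnergy at h1 h2
  have h0 : ∫ x in Ω, (u x - u' x) ^ 2 = 0 := by
    refine le_antisymm ?_ (integral_nonneg fun x ↦ sq_nonneg _)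
    by_contra! hpos
    have := mul_pos (half_pos ha) hpos
    linarith
  have h3 := (integral_eq_zero_iff_of_nonneg (fun x ↦ sq_nonneg _) i4).1 h0
  filter_upwards [h3] with x hx
  exact sub_eq_zero.1 (pow_eq_zero_iff two_ne_zero |>.1 hx)

end SobolevPairs

/-! ### Existence of a minimizer by Hilbert space projection -/

section Existence

variable {d : ℕ}

local notation "𝔼" => EuclideanSpace ℝ (Fin d)

theorem norm_toLp_sq {F : Type*} [NormedAddCommGroup F] [InnerProductSpace ℝ F]
    {μ : Measure 𝔼} {k : 𝔼 → F} (hk : MemLp k 2 μ) : ‖hk.toLp‖ ^ 2 = ∫ x, ‖k x‖ ^ 2 ∂μ := by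
  rw [← real_inner_self_eq_norm_sq, L2.inner_def]
  refine integral_congr_ae ?_
  filter_upwards [hk.coeFn_toLp] with x hx
  rw [hx, real_inner_self_eq_norm_sq]

/-- The pairing of an `L²` pair `(α u, β g)` with a test function and its gradient. -/
noncomputable def testFunctional {μ : Measure 𝔼} (α β : ℝ) (φ : Lp 𝔼 2 μ) (ψ : Lp ℝ 2 μ) :
    WithLp 2 (Lp ℝ 2 μ × Lp 𝔼 2 μ) →L[ℝ] 𝔼 :=
  α⁻¹ • (((ContinuousLinearMap.lsmul ℝ ℝ : ℝ →L[ℝ] 𝔼 →L[ℝ] 𝔼).lpPairing μ 2 2).flip φ).comp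
      (WithLp.fstL 2 ℝ _ _)
    + β⁻¹ • (((ContinuousLinearMap.lsmul ℝ ℝ : ℝ →L[ℝ] 𝔼 →L[ℝ] 𝔼).lpPairing μ 2 2) ψ).comp
      (WithLp.sndL 2 ℝ _ _)

theorem testFunctional_apply {μ : Measure 𝔼} {α β : ℝ} (hα : α ≠ 0) (hβ : β ≠ 0) {φ g : 𝔼 → 𝔼}
    {ψ u : 𝔼 → ℝ} (hφ : MemLp φ 2 μ) (hψ : MemLp ψ 2 μ) (hu : MemLp u 2 μ) (hg : MemLp g 2 μ) :
    testFunctional α β hφ.toLp hψ.toLp (WithLp.toLp 2 (α • hu.toLp, β • hg.toLp))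
      = ∫ x, u x • φ x ∂μ + ∫ x, ψ x • g x ∂μ := by
  have key {k : 𝔼 → ℝ} {l : 𝔼 → 𝔼} (hk : MemLp k 2 μ) (hl : MemLp l 2 μ) :
      (ContinuousLinearMap.lsmul ℝ ℝ : ℝ →L[ℝ] 𝔼 →L[ℝ] 𝔼).lpPairing μ 2 2 hk.toLp hl.toLp
        = ∫ x, k x • l x ∂μ := by
    rw [ContinuousLinearMap.lpPairing_eq_integral]
    refine integral_congr_ae ?_
    filter_upwards [hk.coeFn_toLp, hl.coeFn_toLp] with x h1 h2
    rw [h1, h2]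
    rfl
  simp [testFunctional, key, hα, hβ]

/-- The quadratic energy attains its minimum over `H¹(Ω)`. -/
theorem exists_isMin_quadEnergy {Ω : Set 𝔼} (hΩvol : volume Ω < ⊤) {a b : ℝ} (ha : 0 < a)
    (hb : 0 < b) {u₀ : 𝔼 → ℝ} (hu₀ : MemLp u₀ 2 (volume.restrict Ω)) :
    ∃ u g, IsH1Pair Ω u g ∧
      ∀ w k, IsH1Pair Ω w k → quadEnergy Ω a b u₀ u g ≤ quadEnergy Ω a b u₀ w k := by
  set μ := volume.restrict Ω
  set α := √a with hα
  set β := √b with hβ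
  have hα0 : α ≠ 0 := (Real.sqrt_pos.2 ha).ne'
  have hβ0 : β ≠ 0 := (Real.sqrt_pos.2 hb).ne'
  let H := WithLp 2 (Lp ℝ 2 μ × Lp 𝔼 2 μ)
  let T := {ψ : 𝔼 → ℝ // ContDiff ℝ ∞ ψ ∧ HasCompactSupport ψ ∧ tsupport ψ ⊆ Ω}
  have hψ (ψ : T) : MemLp ψ.1 2 μ := ψ.2.1.continuous.memLp_of_hasCompactSupport ψ.2.2.1
  have hφ (ψ : T) : MemLp (gradient ψ.1) 2 μ :=
    (continuous_gradient (ψ.2.1.of_le (by norm_cast))).memLp_of_hasCompactSupport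
      (hasCompactSupport_gradient ψ.2.2.1)
  -- K consists of the pairs (αu, βg) with g a weak gradient of u, and is closed as an intersection
  -- of kernels. The weights α = √a and β = √b make the squared distance to (αu₀, 0) equal to the
  -- quadratic energy, so the minimizer is the nearest point of K.
  let K : Submodule ℝ H := ⨅ ψ : T, (testFunctional α β (hφ ψ).toLp (hψ ψ).toLp).ker
  let z {u : 𝔼 → ℝ} {g : 𝔼 → 𝔼} (hu : MemLp u 2 μ) (hg : MemLp g 2 μ) : H :=
    WithLp.toLp 2 (α • hu.toLp, β • hg.toLp)
  have hzK {u : 𝔼 → ℝ} {g : 𝔼 → 𝔼} (hu : MemLp u 2 μ) (hg : MemLp g 2 μ) :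
      z hu hg ∈ K ↔ IsH1Pair Ω u g := by
    simp only [K, z, Submodule.mem_iInf, LinearMap.mem_ker, ContinuousLinearMap.coe_coe,
      testFunctional_apply hα0 hβ0, add_eq_zero_iff_eq_neg]
    exact ⟨fun h ↦ ⟨hu, ⟨locallyIntegrableOn_of_memLp hΩvol hu,
      locallyIntegrableOn_of_memLp hΩvol hg, fun ψ h1 h2 h3 ↦ h ⟨ψ, h1, h2, h3⟩⟩, hg⟩,
      fun h ψ ↦ h.2.1.2.2 ψ.1 ψ.2.1 ψ.2.2.1 ψ.2.2.2⟩
  have hKc : IsClosed (K : Set H) := by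
    simp only [K, Submodule.coe_iInf]
    exact isClosed_iInter fun ψ ↦ ContinuousLinearMap.isClosed_ker _
  let z₀ : H := z hu₀ (MemLp.zero : MemLp (0 : 𝔼 → 𝔼) 2 μ)
  have hnorm {u : 𝔼 → ℝ} {g : 𝔼 → 𝔼} (hu : MemLp u 2 μ) (hg : MemLp g 2 μ) :
      ‖z₀ - z hu hg‖ ^ 2 = quadEnergy Ω a b u₀ u g := by
    have e1 : (z₀ - z hu hg).fst = α • (hu₀.sub hu).toLp := by
      rw [MemLp.toLp_sub, smul_sub]; rfl
    have e2 : (z₀ - z hu hg).snd = β • -hg.toLp := by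
      have : (z₀ - z hu hg).snd = β • (MemLp.zero : MemLp (0 : 𝔼 → 𝔼) 2 μ).toLp
        - β • hg.toLp := rfl
      rw [this, MemLp.toLp_zero]; simp
    rw [WithLp.prod_norm_sq_eq_of_L2, e1, e2, norm_smul, norm_smul, norm_neg, mul_pow, mul_pow,
      norm_toLp_sq, norm_toLp_sq, Real.norm_eq_abs, Real.norm_eq_abs, sq_abs, sq_abs,
      Real.sq_sqrt ha.le, Real.sq_sqrt hb.le, ← integral_const_mul, ← integral_const_mul,
      quadEnergy, ← integral_add]
    · refine integral_congr_ae (Filter.Eventually.of_forall fun x ↦ ?_)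
      simp only [Pi.sub_apply, Real.norm_eq_abs, sq_abs]
      ring
    · exact ((memLp_two_iff_integrable_sq_norm (hu₀.sub hu).1).1 (hu₀.sub hu)).const_mul a
    · exact ((memLp_two_iff_integrable_sq_norm hg.1).1 hg).const_mul b
  obtain ⟨y, hyK, hy⟩ := K.exists_norm_eq_iInf_of_complete_subspace hKc.isComplete z₀
  let u : Lp ℝ 2 μ := α⁻¹ • y.fst
  let g : Lp 𝔼 2 μ := β⁻¹ • y.snd
  have hyz : y = z (Lp.memLp u) (Lp.memLp g) := by
    simp only [z, Lp.toLp_coeFn, u, g, smul_smul, mul_inv_cancel₀ hα0, mul_inv_cancel₀ hβ0,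
      one_smul]
    rfl
  refine ⟨u, g, (hzK _ _).1 (hyz ▸ hyK), fun w k hw ↦ ?_⟩
  rw [← hnorm (Lp.memLp u) (Lp.memLp g), ← hnorm hw.1 hw.2.2, ← hyz]
  refine pow_le_pow_left₀ (norm_nonneg _) ?_ 2
  rw [hy]
  exact ciInf_le ⟨0, forall_mem_range.2 fun _ ↦ norm_nonneg _⟩
    (⟨z hw.1 hw.2.2, (hzK _ _).2 hw⟩ : (K : Set H))

end Existence

/-! ### The competitor and the perimeter bound -/

section Competitor

variable {d : ℕ}

local notation "𝔼" => EuclideanSpace ℝ (Fin d)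

theorem integral_smul_gradient {w ψ : 𝔼 → ℝ} (hw : ContDiff ℝ 1 w) (hψ : ContDiff ℝ 1 ψ)
    (hc : HasCompactSupport ψ) : ∫ x, w x • gradient ψ x = - ∫ x, ψ x • gradient w x := by
  have i1 : Integrable fun x ↦ w x • gradient ψ x :=
    (hw.continuous.smul (continuous_gradient hψ)).integrable_of_hasCompactSupport
      (hasCompactSupport_gradient hc).smul_left
  have i2 : Integrable fun x ↦ ψ x • gradient w x :=
    (hψ.continuous.smul (continuous_gradient hw)).integrable_of_hasCompactSupport hc.smul_right
  refine ext_inner_left ℝ fun b ↦ ?_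
  have j1 : Integrable fun x ↦ w x * fderiv ℝ ψ x b :=
    (hw.continuous.mul ((hψ.continuous_fderiv (by norm_num)).clm_apply
      continuous_const)).integrable_of_hasCompactSupport
      (hc.fderiv_apply (𝕜 := ℝ) b).mul_left
  have j2 : Integrable fun x ↦ fderiv ℝ w x b * ψ x :=
    (((hw.continuous_fderiv (by norm_num)).clm_apply
      continuous_const).mul hψ.continuous).integrable_of_hasCompactSupport hc.mul_left
  have j3 : Integrable fun x ↦ w x * ψ x :=
    (hw.continuous.mul hψ.continuous).integrable_of_hasCompactSupport hc.mul_left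
  rw [inner_neg_right, ← integral_inner i1, ← integral_inner i2]
  simp_rw [inner_smul_right, real_inner_comm _ b, ← fderiv_apply_eq_inner_gradient]
  rw [integral_mul_fderiv_eq_neg_fderiv_mul_of_integrable j2 j1 j3
    (fun x _ ↦ hw.differentiable (by norm_num) x) (fun x _ ↦ hψ.differentiable (by norm_num) x)]
  simp_rw [mul_comm]

theorem isH1Pair_of_contDiff {Ω : Set 𝔼} (hΩvol : volume Ω < ⊤) {w : 𝔼 → ℝ}
    (hw : ContDiff ℝ 1 w) (hw2 : MemLp w 2 (volume.restrict Ω))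
    (hw2' : MemLp (gradient w) 2 (volume.restrict Ω)) : IsH1Pair Ω w (gradient w) := by
  refine ⟨hw2, ⟨locallyIntegrableOn_of_memLp hΩvol hw2, locallyIntegrableOn_of_memLp hΩvol hw2',
    fun ψ hψ hc hs ↦ ?_⟩, hw2'⟩
  have h0 (x) (hx : x ∉ Ω) : ψ x = 0 :=
    image_eq_zero_of_notMem_tsupport fun hx' ↦ hx (hs hx')
  obtain ⟨T, -, hgrad⟩ := exists_clm_gradient_eq (d := d)
  have h1 (x) (hx : x ∉ Ω) : gradient ψ x = 0 := by
    rw [hgrad]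
    simp only
    rw [image_eq_zero_of_notMem_tsupport (f := fderiv ℝ ψ)
      (fun hx' ↦ hx (hs (tsupport_fderiv_subset ℝ hx'))), map_zero]
  rw [setIntegral_eq_integral_of_forall_compl_eq_zero fun x hx ↦ by rw [h1 x hx, smul_zero],
    setIntegral_eq_integral_of_forall_compl_eq_zero fun x hx ↦ by rw [h0 x hx, zero_smul]]
  exact integral_smul_gradient hw (hψ.of_le (by norm_cast)) hc

/-- Weighted Young inequality, separating v - f from the mollification error f - χ_V at the price of
a factor 1 + θ, which can be taken arbitrarily close to 1. -/
theorem sq_add_le_mul_sq_add {θ : ℝ} (hθ : 0 < θ) (p q : ℝ) :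
    (p + q) ^ 2 ≤ (1 + θ) * p ^ 2 + (1 + 1 / θ) * q ^ 2 := by
  have h : (1 + θ) * p ^ 2 + (1 + 1 / θ) * q ^ 2 - (p + q) ^ 2 = (θ * p - q) ^ 2 / θ := by
    field_simp
    ring
  have : 0 ≤ (θ * p - q) ^ 2 / θ := by positivity
  linarith

theorem sharpInterface_eq (V : Set 𝔼) (x : 𝔼) :
    sharpInterface V x = 2 * V.indicator 1 x - 1 := by
  by_cases hx : x ∈ V <;> simp [sharpInterface, hx]
  norm_num

theorem measurable_sharpInterface {V : Set 𝔼} (hVm : MeasurableSet V) :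
    Measurable (sharpInterface V) :=
  (measurable_one.indicator hVm).sub (measurable_one.indicator hVm.compl)

theorem memLp_sharpInterface {Ω V : Set 𝔼} (hΩvol : volume Ω < ⊤) (hVm : MeasurableSet V) :
    MemLp (sharpInterface V) 2 (volume.restrict Ω) := by
  have : IsFiniteMeasure (volume.restrict Ω) := ⟨by simpa using hΩvol⟩
  refine MemLp.of_bound (measurable_sharpInterface hVm).aestronglyMeasurable 1
    (Filter.Eventually.of_forall fun x ↦ ?_)
  rw [sharpInterface_eq]
  by_cases hx : x ∈ V <;> simp [hx]
  norm_num

/-- Competitors built from the resolvent of a mollified characteristic function. -/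
theorem exists_competitor {Ω V : Set 𝔼} (hΩvol : volume Ω < ⊤) (hVm : MeasurableSet V)
    (hVb : Bornology.IsBounded V) (hP : perimeter V ≠ ⊤) {b k : ℝ} (hb : 0 < b) (hk : 0 < k)
    {θ δ : ℝ} (hθ : 0 < θ) (hδ : 0 < δ) :
    ∃ w g, IsH1Pair Ω w g ∧ quadEnergy Ω (b * k ^ 2) b (sharpInterface V) w g
      ≤ (1 + θ) * (2 * b * k * (perimeter V).toReal) + 4 * (b * k ^ 2) * (1 + 1 / θ) * δ := by
  have : IsFiniteMeasure (volume.restrict Ω) := ⟨by simpa using hΩvol⟩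
  obtain ⟨f₀, hf, hfc, hf0, hf1, hfδ, hfP⟩ := exists_mollification hVm hVb hδ
  let f : 𝓢(𝔼, ℝ) := hfc.toSchwartzMap hf
  obtain ⟨v, hv⟩ := exists_resolvent hk f
  have hv2 : ContDiff ℝ 2 v := v.smooth 2
  have hgrad := norm_gradient_le hk hv hf0 hf1
  have hflux : - ∫ x, f x * (Δ v) x ≤ k / 2 * (perimeter V).toReal := by
    simp_rw [SchwartzMap.laplacian_apply]
    exact neg_integral_mul_laplacian_le hfc (hfP hP) hv2 (half_pos hk) hgrad
  rw [← integral_resolvent_energy hv] at hflux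
  -- The same affine map sends χ_V to u₀ = 2χ_V - 1; it multiplies the quadratic energy by 4, and 4b
  -- · k/2 = 2bk.
  set w : 𝔼 → ℝ := fun x ↦ 2 * v x - 1 with hwdef
  have hw1 : ContDiff ℝ 1 w := (contDiff_const.mul (v.smooth 1)).sub contDiff_const
  have hwg : gradient w = fun x ↦ (2 : ℝ) • gradient v x := by
    obtain ⟨T, -, hT⟩ := exists_clm_gradient_eq (d := d)
    rw [hT, hT]
    ext1 x
    simp only [hwdef]
    rw [fderiv_sub_const, fderiv_const_mul v.differentiableAt, map_smul]
  have hg2 : MemLp (gradient v) 2 volume :=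
    (memLp_two_iff_integrable_sq_norm
      (contDiff_gradient hv2).continuous.aestronglyMeasurable).2 (integrable_norm_gradient_sq v)
  have hpair : IsH1Pair Ω w (gradient w) := by
    refine isH1Pair_of_contDiff hΩvol hw1 ?_ ?_
    · exact (((v.memLp 2 volume).restrict Ω).const_mul 2).sub (memLp_const 1)
    · rw [hwg]
      exact (hg2.restrict Ω).const_smul (2 : ℝ)
  refine ⟨w, gradient w, hpair, ?_⟩
  have hχ2 : MemLp (V.indicator (1 : 𝔼 → ℝ)) 2 volume := by
    have := memLp_indicator_const (E := ℝ) 2 hVm 1 (Or.inr (hVb.measure_lt_top (μ := volume)).ne)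
    exact this
  have i1 : Integrable fun x ↦ (f x - V.indicator 1 x) ^ 2 :=
    ((f.memLp 2 volume).sub hχ2).integrable_sq
  have i2 : Integrable fun x ↦ k ^ 2 * (v x - f x) ^ 2 + ‖gradient v x‖ ^ 2 :=
    ((((v.memLp 2 volume).sub (f.memLp 2 volume)).integrable_sq).const_mul _).add
      (integrable_norm_gradient_sq v)
  set F : 𝔼 → ℝ := fun x ↦ (1 + θ) * (4 * b) * (k ^ 2 * (v x - f x) ^ 2 + ‖gradient v x‖ ^ 2)
    + 4 * (b * k ^ 2) * (1 + 1 / θ) * (f x - V.indicator 1 x) ^ 2 with hF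
  have iF : Integrable F := (i2.const_mul _).add (i1.const_mul _)
  have hF0 (x) : 0 ≤ F x := by positivity
  have hle (x) : b * k ^ 2 * (w x - sharpInterface V x) ^ 2 + b * ‖gradient w x‖ ^ 2 ≤ F x := by
    have h1 := sq_add_le_mul_sq_add hθ (v x - f x) (f x - V.indicator 1 x)
    have h2 := mul_le_mul_of_nonneg_left h1 (by positivity : 0 ≤ 4 * (b * k ^ 2))
    have h3 : 0 ≤ θ * (4 * b * ‖gradient v x‖ ^ 2) := by positivity
    have h4 : ‖gradient w x‖ ^ 2 = 4 * ‖gradient v x‖ ^ 2 := by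
      rw [hwg, norm_smul, mul_pow]; norm_num
    rw [h4, sharpInterface_eq]
    simp only [hF, hwdef]
    have h5 : b * k ^ 2 * (2 * v x - 1 - (2 * V.indicator 1 x - 1)) ^ 2
        = 4 * (b * k ^ 2) * (v x - f x + (f x - V.indicator 1 x)) ^ 2 := by ring
    rw [h5]
    linarith
  have hδ' : ∫ x, (f x - V.indicator 1 x) ^ 2 ≤ δ := hfδ
  calc quadEnergy Ω (b * k ^ 2) b (sharpInterface V) w (gradient w)
      ≤ ∫ x in Ω, F x := integral_mono
        (integrable_quadEnergy _ _ (memLp_sharpInterface hΩvol hVm) hpair.1 hpair.2.2)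
        iF.integrableOn hle
    _ ≤ ∫ x, F x := setIntegral_le_integral iF (Filter.Eventually.of_forall hF0)
    _ = (1 + θ) * (4 * b) * (∫ x, (k ^ 2 * (v x - f x) ^ 2 + ‖gradient v x‖ ^ 2))
        + 4 * (b * k ^ 2) * (1 + 1 / θ) * ∫ x, (f x - V.indicator 1 x) ^ 2 := by
        rw [← integral_const_mul, ← integral_const_mul,
          ← integral_add (i2.const_mul _) (i1.const_mul _)]
    _ ≤ (1 + θ) * (4 * b) * (k / 2 * (perimeter V).toReal)
        + 4 * (b * k ^ 2) * (1 + 1 / θ) * δ := by gcongr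
    _ = _ := by ring

/-- The minimal quadratic energy is controlled by the perimeter. -/
theorem quadEnergy_le_perimeter {Ω V : Set 𝔼} (hΩvol : volume Ω < ⊤) (hVm : MeasurableSet V)
    (hVb : Bornology.IsBounded V) (hP : perimeter V ≠ ⊤) {b k : ℝ} (hb : 0 < b) (hk : 0 < k)
    {m : ℝ} (hm : ∀ w g, IsH1Pair Ω w g →
      m ≤ quadEnergy Ω (b * k ^ 2) b (sharpInterface V) w g) :
    m ≤ 2 * b * k * (perimeter V).toReal := by
  set P := 2 * b * k * (perimeter V).toReal with hPdef
  have hP0 : 0 ≤ P := by positivity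
  -- The mollification error goes to 0 first, with θ fixed, since its coefficient contains 1/θ. Then
  -- θ = η/(P + 1), where the +1 covers P = 0.
  have h1 (θ : ℝ) (hθ : 0 < θ) : m ≤ (1 + θ) * P := by
    refine le_of_forall_pos_le_add fun η hη ↦ ?_
    have hC : 0 < 4 * (b * k ^ 2) * (1 + 1 / θ) := by positivity
    obtain ⟨w, g, hp, hle⟩ := exists_competitor hΩvol hVm hVb hP hb hk hθ (div_pos hη hC)
    rw [mul_div_cancel₀ _ hC.ne'] at hle
    exact (hm w g hp).trans hle
  refine le_of_forall_pos_le_add fun η hη ↦ ?_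
  have h2 := h1 (η / (P + 1)) (by positivity)
  have h3 : η / (P + 1) * P ≤ η := by
    rw [div_mul_eq_mul_div, div_le_iff₀ (by positivity)]
    nlinarith
  linarith

end Competitor

/-! ### Consequences of the convex-concave splitting of W -/

section Potential

theorem deriv_eq_of_potential {W Wconc : ℝ → ℝ} (hW : ∀ s, W s = s ^ 2 + Wconc s)
    (hC1 : ContDiff ℝ 1 Wconc) (hWnonneg : ∀ s, 0 ≤ W s) {s : ℝ} (hs : W s = 0) :
    deriv Wconc s = -2 * s := by
  have hmin : IsLocalMin W s := Filter.Eventually.of_forall fun t ↦ by rw [hs]; exact hWnonneg t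
  have hd : HasDerivAt W (2 * s + deriv Wconc s) s := by
    have h1 : HasDerivAt (fun t : ℝ ↦ t ^ 2) (2 * s) s := by simpa using hasDerivAt_pow 2 s
    have h2 := h1.add ((hC1.differentiable (by norm_num)) s).hasDerivAt
    exact h2.congr_of_eventuallyEq (Filter.Eventually.of_forall hW)
  have := hmin.hasDerivAt_eq_zero hd
  linarith

/-- The concave part lies below its tangent at s, which has value -s² and slope -2s there; adding t²
completes the square. -/
theorem potential_le_sq {W Wconc : ℝ → ℝ} (hW : ∀ s, W s = s ^ 2 + Wconc s)
    (hconc : ConcaveOn ℝ univ Wconc) (hC1 : ContDiff ℝ 1 Wconc) (hWnonneg : ∀ s, 0 ≤ W s)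
    {s : ℝ} (hs : W s = 0) (t : ℝ) : W t ≤ (t - s) ^ 2 := by
  have hd := deriv_eq_of_potential hW hC1 hWnonneg hs
  have hda : HasDerivAt Wconc (-2 * s) s :=
    hd ▸ ((hC1.differentiable (by norm_num)) s).hasDerivAt
  have hws : Wconc s = -s ^ 2 := by have := hW s; linarith
  have key : Wconc t ≤ Wconc s + (-2 * s) * (t - s) := by
    rcases lt_trichotomy s t with h | h | h
    · have := hconc.slope_le_of_hasDerivAt (mem_univ s) (mem_univ t) h hda
      rw [slope_def_field, div_le_iff₀ (by linarith)] at this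
      linarith
    · simp [h]
    · have := hconc.le_slope_of_hasDerivAt (mem_univ t) (mem_univ s) h hda
      rw [slope_def_field, le_div_iff₀ (by linarith)] at this
      linarith
  rw [hW t]
  rw [hws] at key
  nlinarith

end Potential

/-! ### Reduction of the splitting step to the quadratic energy -/

section SplittingStep

variable {d : ℕ}

local notation "𝔼" => EuclideanSpace ℝ (Fin d)

theorem stepFunctional_eq {Ω : Set 𝔼} (hΩ : IsOpen Ω) (hΩvol : volume Ω < ⊤) {Wconc : ℝ → ℝ}
    {ε τ : ℝ} {u₀ : 𝔼 → ℝ} (hu₀ : MemLp u₀ 2 (volume.restrict Ω)) (hsq : ∀ x, u₀ x ^ 2 = 1)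
    (hd : ∀ x, deriv Wconc (u₀ x) = -2 * u₀ x) {u : 𝔼 → ℝ} {g : 𝔼 → 𝔼} (h : IsH1Pair Ω u g) :
    stepFunctional Ω Wconc ε τ u₀ u
      = quadEnergy Ω (1 / (2 * τ) + 1 / ε) (ε / 2) u₀ u g - 1 / ε * volume.real Ω := by
  have : IsFiniteMeasure (volume.restrict Ω) := ⟨by simpa using hΩvol⟩
  have i1 : Integrable (fun x ↦ 1 / (2 * τ) * (u x - u₀ x) ^ 2) (volume.restrict Ω) :=
    (h.1.sub hu₀).integrable_sq.const_mul _
  have i2 := integrable_quadEnergy (1 / ε) (ε / 2) hu₀ h.1 h.2.2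
  have i3 : Integrable (fun _ : 𝔼 ↦ 1 / ε) (volume.restrict Ω) := integrable_const _
  have e1 : ∫ x in Ω, (ε / 2 * ‖weakGradient Ω u x‖ ^ 2
        + (u x ^ 2 + deriv Wconc (u₀ x) * u x) / ε)
      = ∫ x in Ω, ((1 / ε * (u x - u₀ x) ^ 2 + ε / 2 * ‖g x‖ ^ 2) - 1 / ε) := by
    refine integral_congr_ae ?_
    filter_upwards [weakGradient_ae_eq hΩ h.2.1] with x hx
    have e : u x ^ 2 + -2 * u₀ x * u x = (u x - u₀ x) ^ 2 - 1 := by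
      rw [← hsq x]; ring
    rw [hx, hd, e]
    ring
  rw [stepFunctional, e1, integral_sub i2 i3, ← integral_const_mul, ← add_sub_assoc,
    ← integral_add i1 i2, quadEnergy]
  congr 1
  · refine integral_congr_ae (Filter.Eventually.of_forall fun x ↦ ?_)
    simp only
    ring
  · simp [mul_comm]

/-- Pointwise comparison of integrands. For a = 1/(2τ) + 1/ε the excess over 1/ε is the movement
penalty, which is simply dropped. -/
theorem energy_le_quadEnergy {Ω : Set 𝔼} (hΩ : IsOpen Ω) {W : ℝ → ℝ} {ε a : ℝ} (hε : 0 < ε)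
    (ha : 1 / ε ≤ a) {u₀ : 𝔼 → ℝ} (hu₀ : MemLp u₀ 2 (volume.restrict Ω))
    (hW : ∀ x t, W t ≤ (t - u₀ x) ^ 2) {u : 𝔼 → ℝ} {g : 𝔼 → 𝔼} (h : IsH1Pair Ω u g) :
    energy Ω W ε u ≤ ENNReal.ofReal (quadEnergy Ω a (ε / 2) u₀ u g) := by
  have ha0 : 0 ≤ a := le_trans (by positivity) ha
  rw [quadEnergy, ofReal_integral_eq_lintegral_ofReal (integrable_quadEnergy a _ hu₀ h.1 h.2.2)
    (Filter.Eventually.of_forall fun x ↦ by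
      simp only [Pi.zero_apply]
      positivity), energy]
  refine lintegral_mono_ae ?_
  filter_upwards [weakGradient_ae_eq hΩ h.2.1] with x hx
  rw [hx]
  refine ENNReal.ofReal_le_ofReal ?_
  have h1 : W (u x) / ε ≤ 1 / ε * (u x - u₀ x) ^ 2 := by
    rw [div_eq_mul_one_div, mul_comm]
    exact mul_le_mul_of_nonneg_left (hW x (u x)) (by positivity)
  have h2 := mul_le_mul_of_nonneg_right ha (sq_nonneg (u x - u₀ x))
  linarith

end SplittingStep

end SharpInterface

theorem mainTheorem4 {d : ℕ} (hd : 0 < d)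
    (W Wconc : ℝ → ℝ) (hW : ∀ s, W s = s ^ 2 + Wconc s)
    (hconc : ConcaveOn ℝ univ Wconc) (hC1 : ContDiff ℝ 1 Wconc)
    (hWnonneg : ∀ s, 0 ≤ W s) (hWone : W 1 = 0) (hWnegone : W (-1) = 0)
    (Ω : Set (EuclideanSpace ℝ (Fin d))) (hΩ : IsOpen Ω) (hΩvol : volume Ω < ⊤)
    (V : Set (EuclideanSpace ℝ (Fin d))) (hV : IsOpen V)
    (hVcompact : IsCompact (closure V)) (hVΩ : closure V ⊆ Ω)
    (hVbdry : SharpInterface.HasC2Boundary V)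
    (ε τ : ℝ) (hε : 0 < ε) (hτ : 0 < τ) :
    (∃ u₁, SharpInterface.IsSplittingStep Ω Wconc ε τ (SharpInterface.sharpInterface V) u₁) ∧
    (∀ u₁ u₁',
      SharpInterface.IsSplittingStep Ω Wconc ε τ (SharpInterface.sharpInterface V) u₁ →
      SharpInterface.IsSplittingStep Ω Wconc ε τ (SharpInterface.sharpInterface V) u₁' →
      u₁ =ᵐ[volume.restrict Ω] u₁') ∧
    (∀ u₁,
      SharpInterface.IsSplittingStep Ω Wconc ε τ (SharpInterface.sharpInterface V) u₁ →
      SharpInterface.energy Ω W ε u₁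
          ≤ ENNReal.ofReal (√2 + ε / τ) * SharpInterface.perimeter V ∧
      (ε ≤ τ →
        SharpInterface.energy Ω W ε u₁
          ≤ ENNReal.ofReal (√2 + 1) * SharpInterface.perimeter V)) := by
  open SharpInterface in
  have hVm : MeasurableSet V := hV.measurableSet
  have hVb : Bornology.IsBounded V := hVcompact.isBounded.subset subset_closure
  set u₀ := sharpInterface V with hu₀def
  have hu₀ : MemLp u₀ 2 (volume.restrict Ω) := memLp_sharpInterface hΩvol hVm
  have hcases (x) : u₀ x = 1 ∨ u₀ x = -1 := by
    by_cases hx : x ∈ V <;> simp [u₀, sharpInterface, hx]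
  have hsq (x) : u₀ x ^ 2 = 1 := by rcases hcases x with h | h <;> simp [h]
  have hWu₀ (x) : W (u₀ x) = 0 := by rcases hcases x with h | h <;> simp [h, hWone, hWnegone]
  have hder (x) : deriv Wconc (u₀ x) = -2 * u₀ x :=
    deriv_eq_of_potential hW hC1 hWnonneg (hWu₀ x)
  set a := 1 / (2 * τ) + 1 / ε with hadef
  have ha : 0 < a := by positivity
  have hb : 0 < ε / 2 := half_pos hε
  have hstep {u g} (h : IsH1Pair Ω u g) : stepFunctional Ω Wconc ε τ u₀ u
      = quadEnergy Ω a (ε / 2) u₀ u g - 1 / ε * volume.real Ω :=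
    stepFunctional_eq hΩ hΩvol hu₀ hsq hder h
  have hpair {u} (h : MemH1 Ω u) : ∃ g, IsH1Pair Ω u g := by
    obtain ⟨hu, g, hg, hg2⟩ := h
    exact ⟨g, hu, hg, hg2⟩
  have hmin {u g} (h : IsH1Pair Ω u g) (hu : IsSplittingStep Ω Wconc ε τ u₀ u) :
      ∀ w k, IsH1Pair Ω w k → quadEnergy Ω a (ε / 2) u₀ u g ≤ quadEnergy Ω a (ε / 2) u₀ w k := by
    intro w k hw
    have := hu.2 w ⟨hw.1, k, hw.2.1, hw.2.2⟩
    rw [hstep h, hstep hw] at this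
    linarith
  refine ⟨?_, fun u u' hu hu' ↦ ?_, fun u hu ↦ ?_⟩
  · obtain ⟨u, g, h, hmin⟩ := exists_isMin_quadEnergy hΩvol ha hb hu₀
    refine ⟨u, ⟨h.1, g, h.2.1, h.2.2⟩, fun w hw ↦ ?_⟩
    obtain ⟨k, hk⟩ := hpair hw
    rw [hstep h, hstep hk]
    linarith [hmin w k hk]
  · obtain ⟨g, h⟩ := hpair hu.1
    obtain ⟨g', h'⟩ := hpair hu'.1
    exact ae_eq_of_quadEnergy_le_midpoint ha hb.le hΩvol hu₀ h h' (hmin h hu) (hmin h' hu')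
  · have hmain : energy Ω W ε u ≤ ENNReal.ofReal (√2 + ε / τ) * perimeter V := by
      by_cases hP : perimeter V = ⊤
      -- For infinite perimeter the right side is ⊤, as the constant is positive.
      · rw [hP, ENNReal.mul_top (by simpa using by positivity)]
        exact le_top
      obtain ⟨g, h⟩ := hpair hu.1
      set k := √(2 * a / ε) with hkdef
      have hk : 0 < k := by positivity
      have hak : ε / 2 * k ^ 2 = a := by
        rw [hkdef, Real.sq_sqrt (by positivity)]; field_simp
      have hle := quadEnergy_le_perimeter hΩvol hVm hVb hP hb hk
        (m := quadEnergy Ω a (ε / 2) u₀ u g) (by rw [hak]; exact hmin h hu)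
      -- The left side is εk, whose square is 2εa = 2 + ε/τ; squaring the right side gives at least
      -- that, since 2√2 ≥ 1.
      have hconst : 2 * (ε / 2) * k ≤ √2 + ε / τ := by
        refine le_of_sq_le_sq ?_ (by positivity)
        have h1 : (2 * (ε / 2) * k) ^ 2 = 2 + ε / τ := by
          have : (2 * (ε / 2) * k) ^ 2 = 2 * ε * (ε / 2 * k ^ 2) := by ring
          rw [this, hak, hadef]; field_simp; ring
        have h2 : (√2 + ε / τ) ^ 2 = 2 + 2 * √2 * (ε / τ) + (ε / τ) ^ 2 := by
          have := Real.sq_sqrt (zero_le_two (α := ℝ))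
          linear_combination this
        have h3 : 1 ≤ √2 := Real.one_le_sqrt.2 one_le_two
        have h4 : 0 < ε / τ := by positivity
        rw [h1, h2]
        nlinarith [sq_nonneg (ε / τ)]
      calc energy Ω W ε u ≤ ENNReal.ofReal (quadEnergy Ω a (ε / 2) u₀ u g) :=
            energy_le_quadEnergy hΩ hε (by rw [hadef]; simp [hτ.le]) hu₀
              (fun x t ↦ potential_le_sq hW hconc hC1 hWnonneg (hWu₀ x) t) h
        _ ≤ ENNReal.ofReal ((√2 + ε / τ) * (perimeter V).toReal) :=
            ENNReal.ofReal_le_ofReal (hle.trans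
              (mul_le_mul_of_nonneg_right hconst ENNReal.toReal_nonneg))
        _ = ENNReal.ofReal (√2 + ε / τ) * perimeter V := by
            rw [ENNReal.ofReal_mul (by positivity), ENNReal.ofReal_toReal hP]
    refine ⟨hmain, fun hετ ↦ hmain.trans ?_⟩
    gcongr
    exact (div_le_one hτ).2 hετ
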